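/- Let $C$ be a field of characteristic zero and let $\tilde\partial$ be the $C$-linear derivation of the polynomial ring $C[t_1,t_2,t_3]$ determined by \[ \tilde\partial t_1=t_1(1-t_1^2),\qquad \tilde\partial t_2=t_3-(1-t_1^2)t_2,\qquad \tilde\partial t_3=(1-t_1^2)(t_3-t_2) \] (that is, $\tilde\partial=t_1(1-t_1^2)\frac{d}{dx}$, where $t_1,t_2,t_3$ model $x$ and the complete elliptic integrals $K(x)$, $E(x)$ of the first and second kind). For $w\in\mathbb{R}^3$ and $p\in C[t_1,t_2,t_3]$ let $\deg_w(p)=\sup\{w_1\alpha_1+w_2\alpha_2+w_3\alpha_3 : t_1^{\alpha_1}t_2^{\alpha_2}t_3^{\alpha_3}\text{ occurs in }p\}$, so that $\deg_w(0)=-\infty$. A function $\varphi:\mathbb{R}\to[-\infty,\infty]$ is called a degree bound for $\tilde\partial$ with respect to $w$ if for every nonzero $f$ in the image of $\tilde\partial$ on $C[t_1,t_2,t_3]$ there is $g\in C[t_1,t_2,t_3]$ with $\tilde\partial g=f$ and $\deg_w(g)\le\varphi(\deg_w(f))$. Then the following hold. (1) For every $w_2\in\mathbb{R}$, $\varphi(x)=x$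 is a degree bound for $\tilde\partial$ with respect to $(1,w_2,w_2)$. (2) A smaller degree bound for $\tilde\partial$ with respect to $(1,-1,-1)$ is given by \[ \varphi(x)=\begin{cases}\lfloor x\rfloor & x<0,\\ 0 & 0\le x<3,\\ \lfloor x\rfloor-2 & x\ge 3.\end{cases} \] (3) A smaller degree bound for $\tilde\partial$ with respect to $(1,1,1)$, i.e. with respect to the total degree, is given by \[ \varphi(x)=\begin{cases}-\infty & x<2,\\ 2\lfloor x/2\rfloor & x\ge 2.\end{cases} \] Here "smaller" means pointwise at most $x$, and not equal to the function $x\mapsto x$. -/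

import Mathlib

namespace EllipticDegree

open MvPolynomial

/-- The weighted degree `deg_w(p) = sup {w₁ α₁ + ⋯ + wₙ αₙ | t^α ∈ supp p}` with values in
`[-∞, ∞]`; in particular the zero polynomial has degree `-∞`. -/
noncomputable def wdeg {C : Type*} [CommSemiring C] {n : ℕ} (w : Fin n → ℝ)
    (p : MvPolynomial (Fin n) C) : EReal :=
  ⨆ α ∈ p.support, ((∑ i, w i * (α i : ℝ) : ℝ) : EReal)

theorem wdeg_zero {C : Type*} [CommSemiring C] {n : ℕ} (w : Fin n → ℝ) :
    wdeg w (0 : MvPolynomial (Fin n) C) = ⊥ := by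
  simp [wdeg]

/-- The weighted degree of a nonzero polynomial is a real number. -/
theorem coe_toReal_wdeg {C : Type*} [CommSemiring C] {n : ℕ} (w : Fin n → ℝ)
    {p : MvPolynomial (Fin n) C} (hp : p ≠ 0) :
    (((wdeg w p).toReal : ℝ) : EReal) = wdeg w p := by
  have hs : p.support.Nonempty := by
    simpa [Finset.nonempty_iff_ne_empty, MvPolynomial.support_eq_empty] using hp
  have h : wdeg w p = ((p.support.sup' hs fun α => ∑ i, w i * (α i : ℝ) : ℝ) : EReal) := by
    unfold wdeg
    apply le_antisymm
    · refine iSup₂_le fun α hα => ?_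
      exact_mod_cast Finset.le_sup' (fun α : Fin n →₀ ℕ => ∑ i, w i * (α i : ℝ)) hα
    · obtain ⟨α, hα, he⟩ := Finset.exists_mem_eq_sup' hs
        (fun α : Fin n →₀ ℕ => ∑ i, w i * (α i : ℝ))
      rw [he]
      exact le_iSup₂_of_le α hα le_rfl
  rw [h, EReal.toReal_coe]

/-- `φ : ℝ → [-∞, ∞]` is a degree bound for `L` with respect to the weights `w`: every nonzero
`f` in the image of `L` has a preimage `g` with `deg_w(g) ≤ φ (deg_w(f))`. Since `f ≠ 0`, the
degree of `f` is real, and `EReal.toReal` only changes its type. -/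
def IsDegreeBound {C : Type*} [CommSemiring C] {n : ℕ}
    (L : MvPolynomial (Fin n) C →ₗ[C] MvPolynomial (Fin n) C) (w : Fin n → ℝ)
    (φ : ℝ → EReal) : Prop :=
  ∀ f ∈ LinearMap.range L, f ≠ 0 → ∃ g, f = L g ∧ wdeg w g ≤ φ (wdeg w f).toReal

/-- The `C`-derivation `∂̃ = t₁(1 - t₁²) d/dx` of `C[t₁, t₂, t₃]`, where `t₁, t₂, t₃` model `x`
and the complete elliptic integrals `K(x)`, `E(x)` of the first and second kind. The variables
are indexed by `0, 1, 2`. -/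
noncomputable def ellipticDerivation (C : Type*) [Field C] :
    Derivation C (MvPolynomial (Fin 3) C) (MvPolynomial (Fin 3) C) :=
  MvPolynomial.mkDerivation C
    ![X 0 * (1 - X 0 ^ 2), X 2 - (1 - X 0 ^ 2) * X 1, (1 - X 0 ^ 2) * (X 2 - X 1)]

/-- The bound `φ(x) = x`. -/
noncomputable def idBound : ℝ → EReal := fun x => (x : EReal)

/-- The bound for the weights `(1, -1, -1)`. -/
noncomputable def negBound : ℝ → EReal := fun x =>
  if x < 0 then ((⌊x⌋ : ℝ) : EReal)
  else if x < 3 then 0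
  else (((⌊x⌋ : ℝ) - 2 : ℝ) : EReal)

/-- The bound for the total degree. -/
noncomputable def totalBound : ℝ → EReal := fun x =>
  if x < 2 then ⊥ else ((2 * (⌊x / 2⌋ : ℝ) : ℝ) : EReal)

end EllipticDegree

/-!
Write `x, y, z` for `t₁, t₂, t₃` and `G(a, b, c)` for the coefficient of `x^a y^b z^c` in `g`. The
derivation preserves the degree `k = b + c` in `y, z`, so for weights `(1, w₂, w₂)` everything
reduces to comparing `x`-degrees of the parts of `g` and `∂̃ g` with the same `k`. On coefficients
it is the recurrence `icoeff_ellipticDerivation`.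

Fix `k`, let `d` be the `x`-degree of the part of `g` of degree `k` in `y, z`, and let `c` be
maximal with `G(d, b, c) ≠ 0`, `b = k - c`. The coefficient of `∂̃ g` at `(d + 2, b, c)` is
`-(d - b + c) G(d, b, c)`, so the `x`-degree rises by two unless `d = b - c`. In this resonant case
`k = d + 2c`, hence `d ≤ k` and `d + k = 2b` is even. Moreover `∂̃ g` still has `x`-degree at least
`d` unless `b = 0`, that is, unless the leading monomial is constant: if `G(d - 2, ·, c')` is
nonzero for some `c' ≥ c + 2`, the largest such `c'` gives a nonzero coefficient of `∂̃ g` in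
`x`-degree `d`; if not, the coefficient of `∂̃ g` at `(d, b - 1, c + 1)` is `b G(d, b, c)`, because
`(d - 2, b - 1, c + 1)` is resonant as well and contributes nothing. This is
`exists_mem_support_ellipticDerivation_of_leading`.

Constants lie in the kernel, so preimages may be taken without constant term, and the three bounds
are then arithmetic: the degree never drops; with weights `(1, -1, -1)` resonant parts have degree
`d - k ≤ 0`; with total degree resonant parts have degree `2b ≥ 2`.
-/

namespace EllipticDegree

open MvPolynomial

variable {C : Type*} [Field C]

/-! ### The derivation on coefficients -/

/-- The linear functional extracting the coefficient of `t₁^a t₂^b t₃^c`, with the exponents in `ℤ`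
and the value `0` as soon as one of them is negative. Integer exponents make
`icoeff_ellipticDerivation` a single identity without boundary cases. -/
noncomputable def icoeff (a b c : ℤ) : MvPolynomial (Fin 3) C →ₗ[C] C :=
  if 0 ≤ a ∧ 0 ≤ b ∧ 0 ≤ c then
    lcoeff C (Finsupp.equivFunOnFinite.symm ![a.toNat, b.toNat, c.toNat])
  else 0

theorem icoeff_natCast (s : Fin 3 →₀ ℕ) (p : MvPolynomial (Fin 3) C) :
    icoeff (s 0) (s 1) (s 2) p = coeff s p := by
  have hs : Finsupp.equivFunOnFinite.symm ![s 0, s 1, s 2] = s := by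
    ext i
    fin_cases i <;> rfl
  simp [icoeff, hs]

theorem exists_mem_support_of_icoeff_ne_zero {a b c : ℤ} {p : MvPolynomial (Fin 3) C}
    (h : icoeff a b c p ≠ 0) :
    ∃ s ∈ p.support, (s 0 : ℤ) = a ∧ (s 1 : ℤ) = b ∧ (s 2 : ℤ) = c := by
  by_cases h0 : 0 ≤ a ∧ 0 ≤ b ∧ 0 ≤ c
  · refine ⟨Finsupp.equivFunOnFinite.symm ![a.toNat, b.toNat, c.toNat], ?_, ?_, ?_, ?_⟩
    · simpa [icoeff, h0] using h
    all_goals simp [h0]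
  · simp [icoeff, h0] at h

theorem icoeff_monomial (a b c : ℤ) (s : Fin 3 →₀ ℕ) (r : C) :
    icoeff a b c (monomial s r) =
      if (s 0 : ℤ) = a ∧ (s 1 : ℤ) = b ∧ (s 2 : ℤ) = c then r else 0 := by
  classical
  split_ifs with h
  · obtain ⟨rfl, rfl, rfl⟩ := h
    simp [icoeff_natCast]
  · by_contra hne
    obtain ⟨s', hs', h'⟩ := exists_mem_support_of_icoeff_ne_zero hne
    obtain rfl : s' = s := by simpa using support_monomial_subset hs'
    exact h h'

theorem icoeff_X_pow_mul (a b c : ℤ) (i j k : ℕ) :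
    icoeff a b c (X 0 ^ i * X 1 ^ j * X 2 ^ k : MvPolynomial (Fin 3) C) =
      if (i : ℤ) = a ∧ (j : ℤ) = b ∧ (k : ℤ) = c then 1 else 0 := by
  have h : (X 0 ^ i * X 1 ^ j * X 2 ^ k : MvPolynomial (Fin 3) C) =
      monomial (Finsupp.single 0 i + Finsupp.single 1 j + Finsupp.single 2 k) 1 := by
    simp [X_pow_eq_monomial, monomial_mul]
  rw [h, icoeff_monomial]
  simp

theorem ellipticDerivation_X_pow_mul (i j k : ℕ) :
    ellipticDerivation C (X 0 ^ i * X 1 ^ j * X 2 ^ k) =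
      ((i : C) - j + k) • (X 0 ^ i * X 1 ^ j * X 2 ^ k)
      - ((i : C) - j + k) • (X 0 ^ (i + 2) * X 1 ^ j * X 2 ^ k)
      + (j : C) • (X 0 ^ i * X 1 ^ (j - 1) * X 2 ^ (k + 1))
      - (k : C) • (X 0 ^ i * X 1 ^ (j + 1) * X 2 ^ (k - 1))
      + (k : C) • (X 0 ^ (i + 2) * X 1 ^ (j + 1) * X 2 ^ (k - 1)) := by
  have h0 : ellipticDerivation C (X 0) = X 0 * (1 - X 0 ^ 2) := by
    simp [ellipticDerivation, mkDerivation_X]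
  have h1 : ellipticDerivation C (X 1) = X 2 - (1 - X 0 ^ 2) * X 1 := by
    simp [ellipticDerivation, mkDerivation_X]
  have h2 : ellipticDerivation C (X 2) = (1 - X 0 ^ 2) * (X 2 - X 1) := by
    simp [ellipticDerivation, mkDerivation_X]
  simp only [Derivation.leibniz, Derivation.leibniz_pow, h0, h1, h2, smul_eq_mul, nsmul_eq_mul,
    smul_eq_C_mul, map_add, map_sub, map_natCast]
  -- `i - 1`, `j - 1`, `k - 1` are truncated, but only where the factor `i`, `j`, `k` vanishes
  rcases i with _ | i <;> rcases j with _ | j <;> rcases k with _ | k <;>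
    push_cast [Nat.add_sub_cancel] <;> ring

/-- The derivation as a recurrence on coefficients: it preserves the degree in `t₂, t₃` and maps
the exponent `a` of `t₁` to `a` and `a + 2`. -/
theorem icoeff_ellipticDerivation (a b c : ℤ) (g : MvPolynomial (Fin 3) C) :
    icoeff a b c (ellipticDerivation C g) =
      ((a - b + c : ℤ) : C) * icoeff a b c g
      - ((a - 2 - b + c : ℤ) : C) * icoeff (a - 2) b c g
      + ((b + 1 : ℤ) : C) * icoeff a (b + 1) (c - 1) g
      - ((c + 1 : ℤ) : C) * icoeff a (b - 1) (c + 1) g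
      + ((c + 1 : ℤ) : C) * icoeff (a - 2) (b - 1) (c + 1) g := by
  induction g using MvPolynomial.induction_on' with
  | add p q hp hq =>
    simp only [map_add, hp, hq]
    ring
  | monomial s r =>
    have hs : monomial s r = r • (X 0 ^ s 0 * X 1 ^ s 1 * X 2 ^ s 2 : MvPolynomial (Fin 3) C) := by
      rw [monomial_eq, smul_eq_C_mul, Finsupp.prod_fintype _ _ (by simp), Fin.prod_univ_three]
    rw [hs]
    simp only [Derivation.map_smul, map_smul, map_add, map_sub, ellipticDerivation_X_pow_mul, icoeff_X_pow_mul,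
      smul_eq_mul]
    generalize s 0 = i
    generalize s 1 = j
    generalize s 2 = k
    -- the five summands match one by one
    have e1 : ((i : C) - j + k) * (if (i : ℤ) = a ∧ (j : ℤ) = b ∧ (k : ℤ) = c then 1 else 0) =
        ((a - b + c : ℤ) : C) * (if (i : ℤ) = a ∧ (j : ℤ) = b ∧ (k : ℤ) = c then 1 else 0) := by
      split_ifs with h
      · obtain ⟨rfl, rfl, rfl⟩ := h
        push_cast; ring
      · simp
    have e2 : ((i : C) - j + k) *
          (if ((i + 2 : ℕ) : ℤ) = a ∧ (j : ℤ) = b ∧ (k : ℤ) = c then 1 else 0) =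
        ((a - 2 - b + c : ℤ) : C) *
          (if (i : ℤ) = a - 2 ∧ (j : ℤ) = b ∧ (k : ℤ) = c then 1 else 0) := by
      by_cases h : (i : ℤ) = a - 2 ∧ (j : ℤ) = b ∧ (k : ℤ) = c
      · rw [if_pos h, if_pos (by omega), ← h.1, ← h.2.1, ← h.2.2]
        push_cast; ring
      · rw [if_neg h, if_neg (by omega)]
        simp
    have e3 : (j : C) *
          (if (i : ℤ) = a ∧ ((j - 1 : ℕ) : ℤ) = b ∧ ((k + 1 : ℕ) : ℤ) = c then 1 else 0) =
        ((b + 1 : ℤ) : C) *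
          (if (i : ℤ) = a ∧ (j : ℤ) = b + 1 ∧ (k : ℤ) = c - 1 then 1 else 0) := by
      by_cases h : (i : ℤ) = a ∧ (j : ℤ) = b + 1 ∧ (k : ℤ) = c - 1
      · rw [if_pos h, ← h.2.1]
        rcases j with _ | j
        · simp
        · rw [if_pos (by omega)]
          push_cast; ring
      · rw [if_neg h]
        rcases j with _ | j
        · simp
        · rw [if_neg (by omega)]
          simp
    have e45 : ∀ i' a' : ℤ, (k : C) *
          (if i' = a' ∧ ((j + 1 : ℕ) : ℤ) = b ∧ ((k - 1 : ℕ) : ℤ) = c then 1 else 0) =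
        ((c + 1 : ℤ) : C) *
          (if i' = a' ∧ (j : ℤ) = b - 1 ∧ (k : ℤ) = c + 1 then 1 else 0) := by
      intro i' a'
      by_cases h : i' = a' ∧ (j : ℤ) = b - 1 ∧ (k : ℤ) = c + 1
      · rw [if_pos h, ← h.2.2]
        rcases k with _ | k
        · simp
        · rw [if_pos (by omega)]
          push_cast; ring
      · rw [if_neg h]
        rcases k with _ | k
        · simp
        · rw [if_neg (by omega)]
          simp
    have e5 := e45 ((i + 2 : ℕ) : ℤ) a
    have hi : ((i + 2 : ℕ) : ℤ) = a ↔ (i : ℤ) = a - 2 := by omega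
    simp only [hi] at e2 e5 ⊢
    linear_combination r * (e1 - e2 + e3 - e45 i a + e5)

/-! ### Leading exponents of a polynomial and of its derivative -/

/-- The leading exponent `m` of the part of `g` whose degree in `t₂, t₃` is that of `s`: first the
exponent of `t₁` is maximal, then that of `t₃`. Maximality is stated as vanishing of the
coefficients beyond `m`, the form in which the recurrence uses it. -/
theorem exists_leading_exponent (g : MvPolynomial (Fin 3) C) {s : Fin 3 →₀ ℕ}
    (hs : s ∈ g.support) :
    ∃ m ∈ g.support, m 1 + m 2 = s 1 + s 2 ∧ s 0 ≤ m 0 ∧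
      (∀ a b c : ℤ, b + c = m 1 + m 2 → (m 0 : ℤ) < a → icoeff a b c g = 0) ∧
      (∀ b c : ℤ, b + c = m 1 + m 2 → (m 2 : ℤ) < c → icoeff (m 0) b c g = 0) := by
  classical
  obtain ⟨u, hu, hmax⟩ := Finset.exists_max_image
    (g.support.filter fun u => u 1 + u 2 = s 1 + s 2) (fun u => u 0) ⟨s, by simp_all⟩
  obtain ⟨m, hm, hmax'⟩ := Finset.exists_max_image
    (g.support.filter fun m => m 1 + m 2 = s 1 + s 2 ∧ m 0 = u 0) (fun m => m 2)
    ⟨u, by simp_all⟩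
  rw [Finset.mem_filter] at hu hm
  refine ⟨m, hm.1, hm.2.1, ?_, ?_, ?_⟩
  · have := hmax s (Finset.mem_filter.2 ⟨hs, rfl⟩)
    omega
  · intro a b c hk ha
    by_contra h
    obtain ⟨v, hv, h0, h1, h2⟩ := exists_mem_support_of_icoeff_ne_zero h
    have := hmax v (Finset.mem_filter.2 ⟨hv, by omega⟩)
    omega
  · intro b c hk hc
    by_contra h
    obtain ⟨v, hv, h0, h1, h2⟩ := exists_mem_support_of_icoeff_ne_zero h
    have := hmax' v (Finset.mem_filter.2 ⟨hv, by omega⟩)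
    omega

/-- Outside the resonance `m 0 = m 1 - m 2` the leading exponent `m` of `g` produces the exponent
`m + (2, 0, 0)` in the image; at a resonance the image still reaches `t₁`-degree `m 0`. -/
theorem exists_mem_support_ellipticDerivation_of_leading [CharZero C]
    {g : MvPolynomial (Fin 3) C} {m : Fin 3 →₀ ℕ} (hm : m ∈ g.support) (hm0 : m ≠ 0)
    (h0 : ∀ a b c : ℤ, b + c = m 1 + m 2 → (m 0 : ℤ) < a → icoeff a b c g = 0)
    (h1 : ∀ b c : ℤ, b + c = m 1 + m 2 → (m 2 : ℤ) < c → icoeff (m 0) b c g = 0) :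
    ∃ u ∈ (ellipticDerivation C g).support, u 1 + u 2 = m 1 + m 2 ∧
      (u 0 = m 0 + 2 ∨ (m 1 = m 0 + m 2 ∧ 1 ≤ m 1 ∧ m 0 ≤ u 0)) := by
  have hgm : icoeff (m 0) (m 1) (m 2) g ≠ 0 := by
    rw [icoeff_natCast]
    exact mem_support_iff.1 hm
  by_cases hres : m 1 = m 0 + m 2
  · have hpos : 1 ≤ m 1 := by
      by_contra hlt
      apply hm0
      ext i
      fin_cases i <;> simp <;> omega
    by_cases hlow : ∃ v ∈ g.support, v 1 + v 2 = m 1 + m 2 ∧ v 0 + 2 = m 0 ∧ m 2 + 2 ≤ v 2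
    · -- the largest `t₃`-exponent two steps below the resonance cannot be cancelled
      classical
      obtain ⟨v₀, hv₀, hv₀'⟩ := hlow
      obtain ⟨v, hv, hmax⟩ := Finset.exists_max_image
        (g.support.filter fun v => v 1 + v 2 = m 1 + m 2 ∧ v 0 + 2 = m 0 ∧ m 2 + 2 ≤ v 2)
        (fun v => v 2) ⟨v₀, by rw [Finset.mem_filter]; exact ⟨hv₀, hv₀'⟩⟩
      rw [Finset.mem_filter] at hv
      obtain ⟨hv, hvk, hv0, hv2⟩ := hv
      have hgv : icoeff (v 0) (v 1) (v 2) g ≠ 0 := by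
        rw [icoeff_natCast]
        exact mem_support_iff.1 hv
      have hF : icoeff (m 0) (v 1) (v 2) (ellipticDerivation C g) ≠ 0 := by
        have hz : icoeff ((m 0 : ℤ) - 2) ((v 1 : ℤ) - 1) ((v 2 : ℤ) + 1) g = 0 := by
          by_contra h
          obtain ⟨y, hy, hy0, hy1, hy2⟩ := exists_mem_support_of_icoeff_ne_zero h
          have := hmax y (Finset.mem_filter.2 ⟨hy, by omega, by omega, by omega⟩)
          omega
        rw [icoeff_ellipticDerivation, hz, h1 _ _ (by omega) (by omega),
          h1 _ _ (by omega) (by omega), h1 _ _ (by omega) (by omega),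
          show (m 0 : ℤ) - 2 = v 0 by omega]
        simp only [mul_zero, zero_sub, add_zero, sub_zero, neg_ne_zero]
        exact mul_ne_zero (Int.cast_ne_zero.2 (by omega)) hgv
      obtain ⟨u, hu, hu0, hu1, hu2⟩ := exists_mem_support_of_icoeff_ne_zero hF
      exact ⟨u, hu, by omega, Or.inr ⟨hres, hpos, by omega⟩⟩
    · have hF : icoeff (m 0) ((m 1 : ℤ) - 1) ((m 2 : ℤ) + 1) (ellipticDerivation C g) ≠ 0 := by
        have hz : icoeff ((m 0 : ℤ) - 2) ((m 1 : ℤ) - 1 - 1) ((m 2 : ℤ) + 1 + 1) g = 0 := by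
          by_contra h
          obtain ⟨y, hy, hy0, hy1, hy2⟩ := exists_mem_support_of_icoeff_ne_zero h
          exact hlow ⟨y, hy, by omega, by omega, by omega⟩
        -- the exponent `m + (-2, -1, 1)` is resonant again, so it does not contribute
        have hc : (m 0 : ℤ) - 2 - ((m 1 : ℤ) - 1) + ((m 2 : ℤ) + 1) = 0 := by omega
        rw [icoeff_ellipticDerivation, hz, hc, h1 _ _ (by omega) (by omega),
          h1 ((m 1 : ℤ) - 1 - 1) _ (by omega) (by omega)]
        simp only [mul_zero, Int.cast_zero, zero_mul, sub_zero, zero_add, add_zero,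
          sub_add_cancel, add_sub_cancel_right]
        exact mul_ne_zero (Int.cast_ne_zero.2 (by omega)) hgm
      obtain ⟨u, hu, hu0, hu1, hu2⟩ := exists_mem_support_of_icoeff_ne_zero hF
      exact ⟨u, hu, by omega, Or.inr ⟨hres, hpos, by omega⟩⟩
  · have hF : icoeff ((m 0 : ℤ) + 2) (m 1) (m 2) (ellipticDerivation C g) ≠ 0 := by
      rw [icoeff_ellipticDerivation, add_sub_cancel_right, h0 _ _ _ rfl (by omega),
        h0 _ ((m 1 : ℤ) + 1) _ (by omega) (by omega), h0 _ ((m 1 : ℤ) - 1) _ (by omega) (by omega),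
        h1 ((m 1 : ℤ) - 1) _ (by omega) (by omega)]
      simp only [mul_zero, zero_sub, add_zero, sub_zero, neg_ne_zero]
      exact mul_ne_zero (Int.cast_ne_zero.2 (by omega)) hgm
    obtain ⟨u, hu, hu0, hu1, hu2⟩ := exists_mem_support_of_icoeff_ne_zero hF
    exact ⟨u, hu, by omega, Or.inl (by omega)⟩

/-- Every exponent `s` of a polynomial `g` without constant term is dominated by an exponent `u` of
its derivative; here `d` is the `t₁`-degree of the part of `g` to which `s` belongs, and the second
alternative is the resonant one. -/
theorem exists_dominating_exponent [CharZero C] {g : MvPolynomial (Fin 3) C}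
    (hg : coeff 0 g = 0) {s : Fin 3 →₀ ℕ} (hs : s ∈ g.support) :
    ∃ u ∈ (ellipticDerivation C g).support, u 1 + u 2 = s 1 + s 2 ∧ ∃ d, s 0 ≤ d ∧
      (u 0 = d + 2 ∨ (d ≤ u 0 ∧ ∃ c, s 1 + s 2 = d + 2 * c ∧ 1 ≤ d + c)) := by
  obtain ⟨m, hm, hk, hsm, h0, h1⟩ := exists_leading_exponent g hs
  have hm0 : m ≠ 0 := by
    rintro rfl
    exact mem_support_iff.1 hm hg
  obtain ⟨u, hu, huk, h⟩ := exists_mem_support_ellipticDerivation_of_leading hm hm0 h0 h1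
  refine ⟨u, hu, by omega, m 0, hsm, h.imp id ?_⟩
  rintro ⟨hres, hpos, hle⟩
  exact ⟨hle, m 2, by omega, by omega⟩

/-! ### Degree bounds -/

theorem le_wdeg {n : ℕ} (w : Fin n → ℝ) {p : MvPolynomial (Fin n) C} {s : Fin n →₀ ℕ}
    (hs : s ∈ p.support) : ((∑ i, w i * (s i : ℝ) : ℝ) : EReal) ≤ wdeg w p :=
  le_iSup₂_of_le (f := fun (α : Fin n →₀ ℕ) (_ : α ∈ p.support) =>
    ((∑ i, w i * (α i : ℝ) : ℝ) : EReal)) s hs le_rfl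

theorem exists_wdeg_eq {n : ℕ} (w : Fin n → ℝ) {p : MvPolynomial (Fin n) C} (hp : p ≠ 0) :
    ∃ s ∈ p.support, ∑ i, w i * (s i : ℝ) = (wdeg w p).toReal := by
  obtain ⟨s, hs, hmax⟩ := Finset.exists_max_image p.support
    (fun s => ∑ i, w i * (s i : ℝ)) (support_nonempty.2 hp)
  refine ⟨s, hs, ?_⟩
  have h : wdeg w p = ((∑ i, w i * (s i : ℝ) : ℝ) : EReal) :=
    le_antisymm (iSup₂_le fun u hu => EReal.coe_le_coe_iff.2 (hmax u hu)) (le_wdeg w hs)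
  rw [h, EReal.toReal_coe]

/-- A criterion for degree bounds of the derivation: preimages may be taken without constant term,
and the degree of `f` is the weight of one of its exponents. -/
theorem isDegreeBound_of_forall_support {w : Fin 3 → ℝ} {φ : ℝ → EReal}
    (h : ∀ g : MvPolynomial (Fin 3) C, coeff 0 g = 0 →
      ∀ v ∈ (ellipticDerivation C g).support,
      (∀ u ∈ (ellipticDerivation C g).support,
        w 0 * u 0 + w 1 * u 1 + w 2 * u 2 ≤ w 0 * v 0 + w 1 * v 1 + w 2 * v 2) →
      ∀ s ∈ g.support, ((w 0 * s 0 + w 1 * s 1 + w 2 * s 2 : ℝ) : EReal) ≤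
        φ (w 0 * v 0 + w 1 * v 1 + w 2 * v 2)) :
    IsDegreeBound
      (ellipticDerivation C : MvPolynomial (Fin 3) C →ₗ[C] MvPolynomial (Fin 3) C) w φ := by
  rintro f ⟨g, rfl⟩ hf
  rw [Derivation.coeFn_coe] at hf ⊢
  have hD : ellipticDerivation C (g - MvPolynomial.C (coeff 0 g)) = ellipticDerivation C g := by
    rw [map_sub, derivation_C, sub_zero]
  refine ⟨g - MvPolynomial.C (coeff 0 g), hD.symm, ?_⟩
  obtain ⟨v, hv, hvd⟩ := exists_wdeg_eq w hf
  refine iSup₂_le fun s hs => ?_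
  rw [← hvd]
  simp only [Fin.sum_univ_three]
  refine h _ (by simp) v (by rw [hD]; exact hv) (fun u hu => ?_) s hs
  rw [hD] at hu
  have hle := le_wdeg w hu
  rw [← coe_toReal_wdeg w hf, EReal.coe_le_coe_iff, ← hvd] at hle
  simpa only [Fin.sum_univ_three] using hle

theorem isDegreeBound_idBound [CharZero C] (w₂ : ℝ) : IsDegreeBound
    (ellipticDerivation C : MvPolynomial (Fin 3) C →ₗ[C] MvPolynomial (Fin 3) C)
    ![1, w₂, w₂] idBound := by
  refine isDegreeBound_of_forall_support fun g hg v _ hmax s hs => ?_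
  obtain ⟨u, hu, hk, d, hsd, h⟩ := exists_dominating_exponent hg hs
  have hle := hmax u hu
  have hk' : (u 1 : ℝ) + u 2 = s 1 + s 2 := by exact_mod_cast hk
  have h0 : (s 0 : ℝ) ≤ u 0 := by
    have : s 0 ≤ u 0 := by omega
    exact_mod_cast this
  have hw : w₂ * u 1 + w₂ * u 2 = w₂ * s 1 + w₂ * s 2 := by
    rw [← mul_add, hk', mul_add]
  simp only [idBound, EReal.coe_le_coe_iff]
  simp at hle ⊢
  linarith

theorem isDegreeBound_negBound [CharZero C] : IsDegreeBound
    (ellipticDerivation C : MvPolynomial (Fin 3) C →ₗ[C] MvPolynomial (Fin 3) C)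
    ![1, -1, -1] negBound := by
  refine isDegreeBound_of_forall_support fun g hg v _ hmax s hs => ?_
  obtain ⟨u, hu, hk, d, hsd, h⟩ := exists_dominating_exponent hg hs
  have hle := hmax u hu
  have hcast : ∀ x : Fin 3 →₀ ℕ, (![1, -1, -1] : Fin 3 → ℝ) 0 * x 0 +
      (![1, -1, -1] : Fin 3 → ℝ) 1 * x 1 + (![1, -1, -1] : Fin 3 → ℝ) 2 * x 2 =
      (((x 0 : ℤ) - x 1 - x 2 : ℤ) : ℝ) := by
    intro x
    simp
    ring
  rw [hcast, hcast, Int.cast_le] at hle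
  rw [hcast, hcast]
  simp only [negBound, Int.floor_intCast]
  split_ifs with hneg h3
  · rw [EReal.coe_le_coe_iff, Int.cast_le]
    omega
  · rw [← EReal.coe_zero, EReal.coe_le_coe_iff, ← Int.cast_zero, Int.cast_le]
    have : (v 0 : ℤ) - v 1 - v 2 < 3 := by exact_mod_cast h3
    rcases h with h | ⟨_, c, hc, _⟩ <;> omega
  · have : 3 ≤ (v 0 : ℤ) - v 1 - v 2 := by exact_mod_cast not_lt.1 h3
    rw [EReal.coe_le_coe_iff, show (2 : ℝ) = ((2 : ℤ) : ℝ) by norm_num, ← Int.cast_sub,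
      Int.cast_le]
    rcases h with h | ⟨_, c, hc, _⟩ <;> omega

theorem isDegreeBound_totalBound [CharZero C] : IsDegreeBound
    (ellipticDerivation C : MvPolynomial (Fin 3) C →ₗ[C] MvPolynomial (Fin 3) C)
    ![1, 1, 1] totalBound := by
  refine isDegreeBound_of_forall_support fun g hg v _ hmax s hs => ?_
  obtain ⟨u, hu, hk, d, hsd, h⟩ := exists_dominating_exponent hg hs
  have hle := hmax u hu
  have hcast : ∀ x : Fin 3 →₀ ℕ, (![1, 1, 1] : Fin 3 → ℝ) 0 * x 0 +
      (![1, 1, 1] : Fin 3 → ℝ) 1 * x 1 + (![1, 1, 1] : Fin 3 → ℝ) 2 * x 2 =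
      ((x 0 + x 1 + x 2 : ℕ) : ℝ) := by
    intro x
    simp
  rw [hcast, hcast, Nat.cast_le] at hle
  rw [hcast, hcast]
  -- a resonant part has total degree `d + k = 2 (d + c)`, even and at least `2`
  have h2 : 2 ≤ v 0 + v 1 + v 2 := by
    rcases h with h | ⟨_, c, hc, _⟩ <;> omega
  have hfloor : ⌊((v 0 + v 1 + v 2 : ℕ) : ℝ) / 2⌋ = (((v 0 + v 1 + v 2) / 2 : ℕ) : ℤ) := by
    have := Nat.floor_div_eq_div (K := ℝ) (v 0 + v 1 + v 2) 2
    rw [← this, Int.natCast_floor_eq_floor (by positivity)]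
    norm_num
  have h2' : ¬ ((v 0 + v 1 + v 2 : ℕ) : ℝ) < 2 := by
    rw [not_lt]
    exact_mod_cast h2
  rw [totalBound, if_neg h2', hfloor, EReal.coe_le_coe_iff]
  have : s 0 + s 1 + s 2 ≤ 2 * ((v 0 + v 1 + v 2) / 2) := by
    rcases h with h | ⟨_, c, hc, _⟩ <;> omega
  exact_mod_cast this

theorem negBound_lt_idBound : negBound < idBound := by
  refine lt_of_le_of_ne (fun x => ?_) fun h => ?_
  · have hx := Int.floor_le x
    simp only [negBound, idBound]
    split_ifs with h0 h3
    · exact_mod_cast hx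
    · exact_mod_cast not_lt.1 h0
    · rw [EReal.coe_le_coe_iff]
      linarith
  · have h1 := congrFun h 1
    norm_num [negBound, idBound] at h1

theorem totalBound_lt_idBound : totalBound < idBound := by
  refine lt_of_le_of_ne (fun x => ?_) fun h => ?_
  · have hx := Int.floor_le (x / 2)
    simp only [totalBound, idBound]
    split_ifs with h2
    · exact bot_le
    · rw [EReal.coe_le_coe_iff]
      linarith
  · have h0 := congrFun h 0
    norm_num [totalBound, idBound] at h0

end EllipticDegree

theorem mainTheorem10 (C : Type*) [Field C] [CharZero C] :
    (∀ w₂ : ℝ, EllipticDegree.IsDegreeBound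
      (EllipticDegree.ellipticDerivation C : MvPolynomial (Fin 3) C →ₗ[C] MvPolynomial (Fin 3) C)
      ![1, w₂, w₂] EllipticDegree.idBound) ∧
    (EllipticDegree.IsDegreeBound
      (EllipticDegree.ellipticDerivation C : MvPolynomial (Fin 3) C →ₗ[C] MvPolynomial (Fin 3) C)
      ![1, -1, -1] EllipticDegree.negBound ∧
      EllipticDegree.negBound < EllipticDegree.idBound) ∧
    (EllipticDegree.IsDegreeBound
      (EllipticDegree.ellipticDerivation C : MvPolynomial (Fin 3) C →ₗ[C] MvPolynomial (Fin 3) C)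
      ![1, 1, 1] EllipticDegree.totalBound ∧
      EllipticDegree.totalBound < EllipticDegree.idBound) := by
  exact ⟨EllipticDegree.isDegreeBound_idBound,
    ⟨EllipticDegree.isDegreeBound_negBound, EllipticDegree.negBound_lt_idBound⟩,
    EllipticDegree.isDegreeBound_totalBound, EllipticDegree.totalBound_lt_idBound⟩
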